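/- Let $p$ be a prime, let $\mathbb F_p$ be the field with $p$ elements, and let $G_p=\bigoplus_{n=1}^{\infty}\mathbb F_p$ be the countable direct sum of copies of $\mathbb F_p$ with coordinatewise addition. Put $\delta_2=\frac12$ and $\delta_p=\frac12-\frac1{2p}$ for odd $p$. For an abelian group $G$, a Følner sequence is a sequence $\Phi=(\Phi_n)_{n\in\mathbb N}$ of finite nonempty subsets of $G$ with $\lim_{n\to\infty}|(\Phi_n+g)\triangle\Phi_n|/|\Phi_n|=0$ for every $g\in G$, and the upper Banach density of $A\subseteq G$ is $$d^*(A)=\sup\Big\{\limsup_{n\to\infty}\frac{|A\cap\Phi_n|}{|\Phi_n|} : (\Phi_n)_{n\in\mathbb N}\text{ is a Følner sequence for }G\Big\}.$$ The Bohr topology of $G$ is the weakest topology on $G$ for which every homomorphism $G\to\mathbb R/\mathbb Z$ is continuous; a Bohr neighborhood of $g\in G$ is a set containing a Bohr-open set that contains $g$. Write $A-A=\{a-b: a,b\in A\}$. 1. For every $\varepsilon>0$ there is a set $A\subseteq G_p$ with $d^*(A)>\delta_p-\varepsilon$ such that $A-A$ does not contain a Bohr neighborhood of any $g\in G_p$.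 2. If $A\subseteq G_p$ satisfies $d^*(A)>\delta_p$, then $A-A=G_p$. -/

import Mathlib

open Filter Topology MeasureTheory
open scoped Pointwise

noncomputable section

/-- The countable direct sum of copies of `𝔽_p`, with coordinatewise addition. -/
abbrev Gp (p : ℕ) : Type := ℕ →₀ ZMod p

/-- A Følner sequence of a (discrete) abelian group `G`: a sequence of finite subsets `Φ n`
(nonempty from some index on) with `|(Φ n + g) ∆ Φ n| / |Φ n| → 0` for every `g : G`.
This is Mathlib's notion for the translation action of `G` on itself and counting measure. -/
def IsFolnerSeq {G : Type*} [AddCommGroup G] (Φ : ℕ → Finset G) : Prop :=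
  letI : MeasurableSpace G := ⊤
  IsAddFoelner G (Measure.count : Measure G) atTop (fun n => (Φ n : Set G))

/-- The upper density `limsup |A ∩ Φ n| / |Φ n|` of `A` with respect to a sequence of finite
sets `Φ n`. (The terms lie in `[0, 1]`, so the real `limsup` is the usual one.) -/
def upperDensity {G : Type*} (Φ : ℕ → Finset G) (A : Set G) : ℝ :=
  limsup (fun n => ((A ∩ (Φ n : Set G)).ncard : ℝ) / ((Φ n).card : ℝ)) atTop

/-- The upper Banach density: the supremum of the upper densities of `A` with respect to all
Følner sequences. -/
def upperBanachDensity {G : Type*} [AddCommGroup G] (A : Set G) : ℝ :=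
  sSup {d : ℝ | ∃ Φ : ℕ → Finset G, IsFolnerSeq Φ ∧ d = upperDensity Φ A}

/-- The Bohr topology of a discrete abelian group `G`: the weakest topology for which every
homomorphism `G → ℝ/ℤ` is continuous. -/
abbrev bohrTopology (G : Type*) [AddCommGroup G] : TopologicalSpace G :=
  ⨅ ρ : G →+ UnitAddCircle, TopologicalSpace.induced ρ inferInstance

/-- `B` is a Bohr neighborhood of `g`: it contains a Bohr-open set that contains `g`. -/
def IsBohrNhd {G : Type*} [AddCommGroup G] (B : Set G) (g : G) : Prop :=
  B ∈ @nhds G (bohrTopology G) g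

/-- The critical density `δ_p`: `1/2` for `p = 2`, and `1/2 - 1/(2p)` for odd `p`. -/
def criticalDensity (p : ℕ) : ℝ :=
  if p = 2 then 1 / 2 else 1 / 2 - 1 / (2 * (p : ℝ))

end

/-!
If `g ∉ A - A`, then among `j • g + x`, for `j` in `ZMod p`, no two cyclically consecutive elements
lie in `A`, so at most `p / 2` of them do; averaging over a Følner sequence gives
`d*(A) ≤ ⌊p / 2⌋ / p`, which is the critical density.

The set of the first part is an increasing union of subsets of larger and larger finite subgroups.
Suppose `A ⊆ H` and `e ∈ H` is not in `A - A`. To remove from `A - A` a point of every Bohr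
neighborhood of `g ∈ H` given by `k` characters, append a block `(ZMod p) ^ n` of new coordinates
and replace `A` by the set of `x + a • (g + e) + y`, where `x ∈ A`, `y` is in the block and `a` is
the value that `y` takes most often, by a large margin. For `n → ∞` almost every `y` has such a
value, by an anticoncentration estimate for sums of independent integer variables, so almost no
density is lost. If `u` has few nonzero entries, adding `1 + u` to `y` raises `a` by one, so that
`g + (1 + u)` is not a difference of the new set, while the differences in `H` remain the same.
Finally, the `k` characters take at most `p ^ k` joint values on the basis of the block; moving the
ones of `1` to representatives of these values gives `u` with at most `p ^ k` nonzero entries such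
that all `k` characters vanish at `1 + u`.
-/

open scoped Finset

section Density

open scoped symmDiff

variable {G : Type*} {Φ : ℕ → Finset G} {A : Set G} {c : ℝ}

theorem density_nonneg (Φ : ℕ → Finset G) (A : Set G) (n : ℕ) :
    0 ≤ ((A ∩ Φ n).ncard : ℝ) / #(Φ n) := by positivity

theorem density_le_one (Φ : ℕ → Finset G) (A : Set G) (n : ℕ) :
    ((A ∩ Φ n).ncard : ℝ) / #(Φ n) ≤ 1 := by
  refine div_le_one_of_le₀ ?_ (by positivity)
  rw [← Set.ncard_coe_finset]
  exact_mod_cast Set.ncard_le_ncard Set.inter_subset_right (Φ n).finite_toSet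

theorem upperDensity_le_of_tendsto {u : ℕ → ℝ} (hu : Tendsto u atTop (𝓝 c))
    (h : ∀ n, ((A ∩ Φ n).ncard : ℝ) / #(Φ n) ≤ u n) : upperDensity Φ A ≤ c :=
  hu.limsup_eq ▸ limsup_le_limsup (.of_forall h)
    (isCoboundedUnder_le_of_le _ (density_nonneg Φ A)) hu.isBoundedUnder_le

theorem le_upperDensity (h : ∀ᶠ n in atTop, c ≤ ((A ∩ Φ n).ncard : ℝ) / #(Φ n)) :
    c ≤ upperDensity Φ A :=
  le_limsup_of_frequently_le h.frequently (isBoundedUnder_of ⟨1, density_le_one Φ A⟩)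

variable [AddCommGroup G]

theorem upperDensity_le_upperBanachDensity (hΦ : IsFolnerSeq Φ) (A : Set G) :
    upperDensity Φ A ≤ upperBanachDensity A := by
  refine le_csSup ⟨1, ?_⟩ ⟨Φ, hΦ, rfl⟩
  rintro d ⟨Ψ, -, rfl⟩
  exact upperDensity_le_of_tendsto tendsto_const_nhds (density_le_one Ψ A)

theorem IsFolnerSeq.tendsto_ncard_symmDiff (hΦ : IsFolnerSeq Φ) (g : G) :
    Tendsto (fun n => (((g +ᵥ (Φ n : Set G)) ∆ Φ n).ncard : ℝ) / #(Φ n)) atTop (𝓝 0) := by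
  let _ : MeasurableSpace G := ⊤
  have tendsto_measure := hΦ.tendsto_meas_vadd_symmDiff g
  refine ((ENNReal.tendsto_toReal ENNReal.zero_ne_top).comp tendsto_measure).congr fun n => ?_
  have finite_symmDiff : ((g +ᵥ (Φ n : Set G)) ∆ Φ n).Finite :=
    (Φ n).finite_toSet.vadd_set.symmDiff (Φ n).finite_toSet
  rw [Function.comp_apply, ENNReal.toReal_div, Measure.count_apply_finset,
    Measure.count_apply_finite _ finite_symmDiff, Set.ncard_eq_toFinset_card _ finite_symmDiff,
    ENNReal.toReal_natCast, ENNReal.toReal_natCast]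

theorem isFolnerSeq_of_eventually_vadd_eq (hne : ∀ n, (Φ n).Nonempty)
    (hΦ : ∀ g : G, ∀ᶠ n in atTop, g +ᵥ (Φ n : Set G) = Φ n) : IsFolnerSeq Φ := by
  let _ : MeasurableSpace G := ⊤
  refine ⟨.of_forall fun _ => trivial, .of_forall fun n => ?_, .of_forall fun n => ?_,
    fun g => tendsto_const_nhds.congr' ?_⟩
  · simpa using (hne n).ne_empty
  · simp
  · filter_upwards [hΦ g] with n hn
    simp [hn]

theorem ncard_inter_le_ncard_add_ncard_symmDiff (A : Set G) (F : Finset G) (g : G) :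
    (A ∩ F).ncard ≤ {x ∈ (F : Set G) | g + x ∈ A}.ncard + ((g +ᵥ (F : Set G)) ∆ F).ncard := by
  have finite_sep : {x ∈ (F : Set G) | g + x ∈ A}.Finite := F.finite_toSet.sep _
  have finite_symmDiff : ((g +ᵥ (F : Set G)) ∆ F).Finite :=
    F.finite_toSet.vadd_set.symmDiff F.finite_toSet
  rw [← Set.ncard_image_of_injective {x ∈ (F : Set G) | g + x ∈ A} (add_right_injective g)]
  refine (Set.ncard_le_ncard ?_ ((finite_sep.image _).union finite_symmDiff)).trans
    (Set.ncard_union_le _ _)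
  rintro x ⟨hxA, hxF⟩
  by_cases hx : x ∈ g +ᵥ (F : Set G)
  · obtain ⟨y, hy, rfl⟩ := hx
    exact .inl ⟨y, ⟨hy, hxA⟩, rfl⟩
  · exact .inr (.inr ⟨hxF, hx⟩)

variable {ι : Type*} [Fintype ι]

theorem sum_ncard_add_mem_le (h : ι → G) {k : ℕ} (hk : ∀ x, {i | h i + x ∈ A}.ncard ≤ k)
    (F : Finset G) : ∑ i, {x ∈ (F : Set G) | h i + x ∈ A}.ncard ≤ #F * k := by
  classical
  calc ∑ i, {x ∈ (F : Set G) | h i + x ∈ A}.ncard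
      = ∑ i, #{x ∈ F | h i + x ∈ A} := by
        simp_rw [← Set.ncard_coe_finset, Finset.coe_filter, Finset.mem_coe]
    _ = ∑ x ∈ F, #{i | h i + x ∈ A} := Finset.sum_card_bipartiteAbove_eq_sum_card_bipartiteBelow _
    _ ≤ #F * k := Finset.sum_le_card_nsmul _ _ _ fun x _ => by
        simpa [← Set.ncard_coe_finset] using hk x

theorem upperBanachDensity_le_of_forall_ncard_le [Nonempty ι] (h : ι → G) {k : ℕ}
    (hk : ∀ x, {i | h i + x ∈ A}.ncard ≤ k) :
    upperBanachDensity A ≤ k / Fintype.card ι := by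
  refine Real.sSup_le ?_ (by positivity)
  rintro d ⟨Φ, hΦ, rfl⟩
  set r : ι → ℕ → ℝ := fun i n => ((h i +ᵥ (Φ n : Set G)) ∆ Φ n).ncard / #(Φ n) with hr
  have tendsto_bound : Tendsto (fun n => (k + ∑ i, r i n) / Fintype.card ι) atTop
      (𝓝 (k / Fintype.card ι)) := by
    simpa using (tendsto_const_nhds.add (tendsto_finsetSum Finset.univ fun i _ =>
      hΦ.tendsto_ncard_symmDiff (h i))).div_const (Fintype.card ι : ℝ)
  refine upperDensity_le_of_tendsto tendsto_bound fun n => ?_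
  have double_count : Fintype.card ι * (A ∩ Φ n).ncard ≤
      #(Φ n) * k + ∑ i, ((h i +ᵥ (Φ n : Set G)) ∆ Φ n).ncard := by
    refine le_trans ?_ (add_le_add_left (sum_ncard_add_mem_le h hk (Φ n)) _)
    rw [← Finset.sum_add_distrib, ← Finset.card_univ, ← smul_eq_mul]
    exact Finset.card_nsmul_le_sum _ _ _ fun i _ => ncard_inter_le_ncard_add_ncard_symmDiff ..
  rw [le_div_iff₀' (by exact_mod_cast Fintype.card_pos), hr, ← Finset.sum_div, ← mul_div_assoc]
  rcases (#(Φ n)).eq_zero_or_pos with h0 | hpos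
  · simp [h0]
  · rw [← mul_div_cancel_left₀ (k : ℝ) (Nat.cast_pos.2 hpos).ne', ← add_div]
    gcongr
    exact_mod_cast double_count

end Density

theorem two_mul_card_le_of_add_one_notMem {p : ℕ} [NeZero p] (J : Finset (ZMod p))
    (hJ : ∀ j ∈ J, j + 1 ∉ J) : 2 * #J ≤ p := by
  have disjoint : Disjoint J (J.map (addRightEmbedding 1)) := by
    simpa [Finset.disjoint_right] using hJ
  calc 2 * #J = #(J ∪ J.map (addRightEmbedding 1)) := by
        rw [Finset.card_union_of_disjoint disjoint, Finset.card_map, two_mul]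
    _ ≤ p := (Finset.card_le_univ _).trans_eq (ZMod.card p)

theorem upperBanachDensity_le_of_notMem_sub {p : ℕ} [NeZero p] {G : Type*} [AddCommGroup G]
    [Module (ZMod p) G] {A : Set G} {g : G} (hg : g ∉ A - A) :
    upperBanachDensity A ≤ ((p / 2 : ℕ) : ℝ) / p := by
  classical
  have := upperBanachDensity_le_of_forall_ncard_le (A := A) (k := p / 2)
    (fun j : ZMod p => j • g) fun x => ?_
  · rwa [ZMod.card] at this
  rw [Set.ncard_eq_toFinset_card', Nat.le_div_iff_mul_le two_pos, mul_comm]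
  refine two_mul_card_le_of_add_one_notMem _ fun j hj hj' => hg ?_
  rw [Set.mem_toFinset, Set.mem_ofPred_eq] at hj hj'
  exact ⟨_, hj', _, hj, by simp only [add_smul, one_smul]; abel⟩

section Anticoncentration

open AddCircle

theorem fourier_sum {T : ℝ} {ι : Type*} (s : Finset ι) (k : ι → ℤ) (θ : AddCircle T) :
    fourier (∑ i ∈ s, k i) θ = ∏ i ∈ s, fourier (k i) θ := by
  induction s using Finset.cons_induction with
  | empty => simp
  | cons i s hi ih => rw [Finset.sum_cons, Finset.prod_cons, fourier_add, ih]

variable {T : ℝ} [Fact (0 < T)]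

theorem integral_fourier (k : ℤ) :
    ∫ θ : AddCircle T, fourier k θ ∂haarAddCircle = if k = 0 then 1 else 0 := by
  split_ifs with hk
  · simp [hk]
  · exact integral_eq_zero_of_add_right_eq_neg (fourier_add_half_inv_index hk Fact.out)

theorem ae_fourier_ne {k l : ℤ} (hkl : k ≠ l) :
    ∀ᵐ θ : AddCircle T ∂haarAddCircle, fourier k θ ≠ fourier l θ := by
  have : Nontrivial (AddCircle T) := by
    have addOrderOf_half := addOrderOf_period_div (p := T) two_pos
    refine ⟨(T / (2 : ℕ) : ℝ), 0, fun half_eq_zero => ?_⟩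
    rw [half_eq_zero, addOrderOf_zero] at addOrderOf_half
    omega
  have finite : {θ : AddCircle T | fourier k θ = fourier l θ}.Finite := by
    refine (finite_torsion T (Int.natAbs_pos.2 (sub_ne_zero.2 hkl))).subset fun θ hθ => ?_
    have zsmul_eq : k • θ = l • θ := injective_toCircle (Fact.out : 0 < T).ne' (Subtype.ext hθ)
    rwa [Set.mem_ofPred_eq, natAbs_nsmul_eq_zero, sub_zsmul, ← sub_eq_add_neg, sub_eq_zero]
  exact finite.countable.ae_notMem _

variable {α : Type*} [Fintype α]

theorem ncard_sum_eq_eq_integral {ι : Type*} [Fintype ι] (X : α → ℤ) (w : ℤ) :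
    ({y : ι → α | ∑ i, X (y i) = w}.ncard : ℂ) =
      ∫ θ : AddCircle T, fourier (-w) θ * (∑ c, fourier (X c) θ) ^ Fintype.card ι
        ∂haarAddCircle := by
  classical
  have expand (θ : AddCircle T) : fourier (-w) θ * (∑ c, fourier (X c) θ) ^ Fintype.card ι =
      ∑ y : ι → α, fourier (∑ i, X (y i) - w) θ := by
    rw [← Finset.card_univ, ← Finset.prod_const, Finset.prod_univ_sum, Finset.mul_sum,
      Fintype.piFinset_univ]
    refine Finset.sum_congr rfl fun y _ => ?_
    rw [← fourier_sum, ← fourier_add, neg_add_eq_sub]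
  simp_rw [expand]
  rw [integral_finsetSum _ fun y _ =>
    (map_continuous (fourier _)).integrable_of_hasCompactSupport (.of_compactSpace _)]
  simp_rw [integral_fourier, sub_eq_zero, Finset.sum_boole]
  rw [Set.ncard_eq_toFinset_card', Set.toFinset_ofPred]

theorem tendsto_ncard_sum_eq {X : α → ℤ} {a b : α} (hab : X a ≠ X b) (w : ℤ) :
    Tendsto (fun n => ({y : Fin n → α | ∑ i, X (y i) = w}.ncard : ℝ) /
      (Fintype.card α : ℝ) ^ n) atTop (𝓝 0) := by
  have card_ne_zero : (Fintype.card α : ℝ) ≠ 0 :=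
    Nat.cast_ne_zero.2 (Fintype.card_pos_iff.2 ⟨a⟩).ne'
  set φ : UnitAddCircle → ℂ := fun θ => ∑ c, (Fintype.card α : ℝ)⁻¹ • fourier (X c) θ with hφ
  have norm_φ_lt : ∀ᵐ θ ∂haarAddCircle, ‖φ θ‖ < 1 := by
    filter_upwards [ae_fourier_ne hab] with θ hθ
    exact norm_sum_lt_of_strictConvexSpace (fun c _ => by positivity) (by simp [card_ne_zero])
      (Finset.mem_univ a) (Finset.mem_univ b) hθ (inv_ne_zero card_ne_zero)
      (inv_ne_zero card_ne_zero) fun c _ => (Circle.norm_coe _).le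
  have norm_integrand (n : ℕ) (θ : UnitAddCircle) : ‖fourier (-w) θ * φ θ ^ n‖ = ‖φ θ‖ ^ n := by
    rw [norm_mul, norm_pow, fourier_apply, Circle.norm_coe, one_mul]
  have tendsto_integral :
      Tendsto (fun n => ∫ θ, fourier (-w) θ * φ θ ^ n ∂haarAddCircle) atTop (𝓝 0) := by
    rw [← integral_zero UnitAddCircle ℂ (μ := haarAddCircle)]
    refine tendsto_integral_of_dominated_convergence 1 (fun n => ?_) (integrable_const 1)
      (fun n => ?_) ?_
    · exact Continuous.aestronglyMeasurable (by fun_prop)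
    · filter_upwards [norm_φ_lt] with θ hθ
      rw [norm_integrand]
      exact pow_le_one₀ (norm_nonneg _) hθ.le
    · filter_upwards [norm_φ_lt] with θ hθ
      rw [tendsto_zero_iff_norm_tendsto_zero]
      simpa only [norm_integrand] using tendsto_pow_atTop_nhds_zero_of_lt_one (norm_nonneg _) hθ
  have density_eq (n : ℕ) : (({y : Fin n → α | ∑ i, X (y i) = w}.ncard /
      (Fintype.card α : ℝ) ^ n : ℝ) : ℂ) =
        ∫ θ, fourier (-w) θ * φ θ ^ n ∂haarAddCircle := by
    simp_rw [hφ, ← Finset.smul_sum, smul_pow, mul_smul_comm]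
    rw [integral_smul]
    have := ncard_sum_eq_eq_integral (T := 1) (ι := Fin n) X w
    rw [Fintype.card_fin] at this
    rw [← this, Complex.real_smul]
    push_cast
    rw [inv_pow, div_eq_inv_mul]
  rw [← tendsto_ofReal_iff]
  simpa only [density_eq, Complex.ofReal_zero] using tendsto_integral

end Anticoncentration

section Plurality

variable {ι α : Type*} [Fintype ι] [DecidableEq α] {L : ℕ} {y z : ι → α} {a b : α}

/-- The value `a` is taken by `y` more than `L` times more often than any other value. -/
def IsPlurality (L : ℕ) (y : ι → α) (a : α) : Prop :=
  ∀ b, b ≠ a → #{i | y i = b} + L < #{i | y i = a}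

theorem IsPlurality.mono {M : ℕ} (h : IsPlurality M y a) (hLM : L ≤ M) : IsPlurality L y a :=
  fun b hb => (Nat.add_le_add_left hLM _).trans_lt (h b hb)

theorem IsPlurality.unique (ha : IsPlurality L y a) (hb : IsPlurality L y b) : a = b := by
  by_contra hab
  have := ha b (Ne.symm hab)
  have := hb a hab
  omega

theorem isPlurality_const (h : L < Fintype.card ι) (a : α) :
    IsPlurality L (fun _ : ι => a) a := by
  intro b hb
  simpa [hb.symm] using h

theorem IsPlurality.const_add [AddGroup α] (h : IsPlurality L y a) (t : α) :
    IsPlurality L (fun i => t + y i) (t + a) := by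
  have card_eq (c : α) : #{i | t + y i = c} = #{i | y i = -t + c} := by
    simp only [eq_neg_add_iff_add_eq]
  intro b hb
  rw [card_eq, card_eq, neg_add_cancel_left]
  exact h _ fun hba => hb (neg_add_eq_iff_eq_add.1 hba)

theorem card_eq_le_card_eq_add_hammingDist (y z : ι → α) (a : α) :
    #{i | y i = a} ≤ #{i | z i = a} + hammingDist y z := by
  classical
  refine (Finset.card_le_card fun i hi => ?_).trans (Finset.card_union_le _ _)
  simp only [Finset.mem_union, Finset.mem_filter, Finset.mem_univ, true_and] at hi ⊢
  by_cases h : y i = z i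
  · exact .inl (h ▸ hi)
  · exact .inr h

theorem IsPlurality.of_hammingDist_le {K : ℕ} (h : IsPlurality (2 * K) y a)
    (hK : hammingDist y z ≤ K) : IsPlurality 0 z a := by
  intro b hb
  have margin := h b hb
  have le_a := card_eq_le_card_eq_add_hammingDist y z a
  have le_b := card_eq_le_card_eq_add_hammingDist z y b
  rw [hammingDist_comm] at le_b
  omega

theorem exists_sum_ite_sub_ite_eq_of_forall_not_isPlurality [Finite α] [Nonempty α]
    (h : ∀ a, ¬ IsPlurality L y a) : ∃ a b, a ≠ b ∧ ∃ w ∈ Finset.Icc (-(L : ℤ)) L,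
      ∑ i, ((if y i = a then 1 else 0) - (if y i = b then 1 else 0) : ℤ) = w := by
  obtain ⟨a, ha⟩ := Finite.exists_max fun a => #{i | y i = a}
  obtain ⟨b, hb, hle⟩ : ∃ b, b ≠ a ∧ #{i | y i = a} ≤ #{i | y i = b} + L := by
    simpa [IsPlurality] using h a
  refine ⟨a, b, hb.symm, _, ?_, rfl⟩
  rw [Finset.sum_sub_distrib, Finset.sum_boole, Finset.sum_boole, Finset.mem_Icc]
  have := ha b
  omega

theorem tendsto_ncard_forall_not_isPlurality [Fintype α] [Nonempty α] (L : ℕ) :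
    Tendsto (fun n => ({y : Fin n → α | ∀ a, ¬ IsPlurality L y a}.ncard : ℝ) /
      (Fintype.card α : ℝ) ^ n) atTop (𝓝 0) := by
  classical
  set X : α → α → α → ℤ := fun a b c => (if c = a then 1 else 0) - if c = b then 1 else 0 with hX
  set s : Finset ((α × α) × ℤ) := Finset.univ.offDiag ×ˢ Finset.Icc (-(L : ℤ)) L with hs
  have tendsto_sum : Tendsto (fun n => ∑ q ∈ s,
      ({y : Fin n → α | ∑ i, X q.1.1 q.1.2 (y i) = q.2}.ncard : ℝ) / (Fintype.card α : ℝ) ^ n)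
      atTop (𝓝 0) := by
    rw [← Finset.sum_const_zero (s := s)]
    refine tendsto_finsetSum s fun q hq => ?_
    have hne : q.1.1 ≠ q.1.2 := (Finset.mem_offDiag.1 (Finset.mem_product.1 hq).1).2.2
    exact tendsto_ncard_sum_eq (a := q.1.1) (b := q.1.2) (by simp [hX, hne, hne.symm]) q.2
  refine squeeze_zero (fun n => by positivity) (fun n => ?_) tendsto_sum
  rw [← Finset.sum_div]
  gcongr
  have subset : {y : Fin n → α | ∀ a, ¬ IsPlurality L y a} ⊆
      ⋃ q ∈ s, {y | ∑ i, X q.1.1 q.1.2 (y i) = q.2} := by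
    intro y hy
    obtain ⟨a, b, hab, w, hw, hsum⟩ := exists_sum_ite_sub_ite_eq_of_forall_not_isPlurality hy
    exact Set.mem_biUnion (x := ((a, b), w)) (by simp [hs, hab, Finset.mem_Icc.1 hw]) hsum
  exact_mod_cast (Set.ncard_le_ncard subset (Set.toFinite _)).trans (s.set_ncard_biUnion_le _)

theorem tendsto_ncard_exists_isPlurality [Fintype α] [Nonempty α] (L : ℕ) :
    Tendsto (fun n => ({y : Fin n → α | ∃ a, IsPlurality L y a}.ncard : ℝ) /
      (Fintype.card α : ℝ) ^ n) atTop (𝓝 1) := by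
  have := (tendsto_ncard_forall_not_isPlurality (α := α) L).const_sub 1
  rw [sub_zero] at this
  refine this.congr fun n => ?_
  have card_ne_zero : (Fintype.card α : ℝ) ^ n ≠ 0 := by simp
  have compl_eq : {y : Fin n → α | ∃ a, IsPlurality L y a}ᶜ =
      {y | ∀ a, ¬ IsPlurality L y a} := by
    ext; simp
  have ncard_add := Set.ncard_add_ncard_compl {y : Fin n → α | ∃ a, IsPlurality L y a}
  rw [compl_eq, Nat.card_eq_fintype_card, Fintype.card_fun, Fintype.card_fin] at ncard_add
  rw [sub_eq_iff_eq_add, ← add_div, eq_div_iff card_ne_zero, one_mul]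
  exact_mod_cast ncard_add.symm

end Plurality

section TwistedSum

theorem eq_and_eq_of_add_map_eq_add_map {R M G : Type*} [Ring R] [AddCommGroup M] [Module R M]
    [AddCommGroup G] [Module R G] {f : M →ₗ[R] G} {H : Submodule R G}
    (hf : Function.Injective f) (hH : Disjoint H (LinearMap.range f)) {h h' : G} (hh : h ∈ H)
    (hh' : h' ∈ H) {y y' : M} (heq : h + f y = h' + f y') : h = h' ∧ y = y' := by
  have sub_eq : h - h' = f (y' - y) := by rw [map_sub]; grind
  have h_eq : h = h' := sub_eq_zero.1 <|
    Submodule.disjoint_def.1 hH _ (H.sub_mem hh hh') (sub_eq ▸ ⟨_, rfl⟩)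
  exact ⟨h_eq, hf (add_left_cancel (h_eq ▸ heq))⟩

variable {R G ι : Type*} [Ring R] [DecidableEq R] [AddCommGroup G] [Module R G] [Fintype ι]

/-- The set of all `x + a • t + f y`, where `x ∈ A` and `a` is the value that `y` takes most
often, with margin `L`. -/
def twistedSum (A : Set G) (t : G) (f : (ι → R) →ₗ[R] G) (L : ℕ) : Set G :=
  {z | ∃ x ∈ A, ∃ y a, IsPlurality L y a ∧ x + a • t + f y = z}

variable {A : Set G} {t : G} {f : (ι → R) →ₗ[R] G} {L : ℕ} {H : Submodule R G}

theorem subset_twistedSum (hL : L < Fintype.card ι) : A ⊆ twistedSum A t f L :=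
  fun x hx => ⟨x, hx, 0, 0, isPlurality_const hL 0, by simp⟩

theorem twistedSum_subset (hA : A ⊆ H) (ht : t ∈ H) :
    twistedSum A t f L ⊆ (H ⊔ LinearMap.range f : Submodule R G) := by
  rintro _ ⟨x, hx, y, a, -, rfl⟩
  exact Submodule.add_mem_sup (H.add_mem (hA hx) (H.smul_mem a ht)) ⟨y, rfl⟩

theorem ncard_twistedSum (hf : Function.Injective f) (hH : Disjoint H (LinearMap.range f))
    (hA : A ⊆ H) (ht : t ∈ H) :
    (twistedSum A t f L).ncard = A.ncard * {y : ι → R | ∃ a, IsPlurality L y a}.ncard := by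
  choose! a ha using fun (y : ι → R) (hy : ∃ a, IsPlurality L y a) => hy
  have eq_image : twistedSum A t f L =
      (fun q : G × (ι → R) => q.1 + a q.2 • t + f q.2) ''
        (A ×ˢ {y : ι → R | ∃ a, IsPlurality L y a}) := by
    ext z
    constructor
    · rintro ⟨x, hx, y, b, hb, rfl⟩
      exact ⟨(x, y), ⟨hx, b, hb⟩, by simp only [(ha y ⟨b, hb⟩).unique hb]⟩
    · rintro ⟨⟨x, y⟩, ⟨hx, hy⟩, rfl⟩
      exact ⟨x, hx, y, a y, ha y hy, rfl⟩
  rw [eq_image, Set.InjOn.ncard_image, Set.ncard_prod]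
  rintro ⟨x, y⟩ ⟨hx, -⟩ ⟨x', y'⟩ ⟨hx', -⟩ heq
  obtain ⟨h_eq, rfl⟩ := eq_and_eq_of_add_map_eq_add_map hf hH
    (H.add_mem (hA hx) (H.smul_mem _ ht)) (H.add_mem (hA hx') (H.smul_mem _ ht)) heq
  exact Prod.ext (add_right_cancel h_eq) rfl

theorem twistedSum_sub_twistedSum_inter_subset (hf : Function.Injective f)
    (hH : Disjoint H (LinearMap.range f)) (hA : A ⊆ H) (ht : t ∈ H) :
    (twistedSum A t f L - twistedSum A t f L) ∩ H ⊆ A - A := by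
  rintro _ ⟨⟨_, ⟨x, hx, y, a, hy, rfl⟩, _, ⟨x', hx', y', a', hy', rfl⟩, rfl⟩, hz⟩
  obtain ⟨h_eq, rfl⟩ := eq_and_eq_of_add_map_eq_add_map hf hH
    (H.add_mem (hA hx) (H.smul_mem a ht))
    (H.add_mem hz (H.add_mem (hA hx') (H.smul_mem a' ht))) (y := y) (y' := y')
    (by rw [add_assoc (_ - _), sub_add_cancel])
  obtain rfl := hy.unique hy'
  exact ⟨x, hx, x', hx', by simp⟩

/-- If `g + f (1 + u)` were the difference of the elements attached to `(x, y)` and `(x', y')`,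
then `y` would be within Hamming distance `K` of `1 + y'`, so the plurality value of `y` would
exceed that of `y'` by one, and comparing `H`-components would give `e = x' - x`. -/
theorem add_map_one_add_notMem_twistedSum_sub (hf : Function.Injective f)
    (hH : Disjoint H (LinearMap.range f)) (hA : A ⊆ H) {g e : G} {K : ℕ} (hg : g ∈ H) (he : e ∈ H)
    (heA : e ∉ A - A) {u : ι → R} (hu : hammingNorm u ≤ K) :
    g + f (1 + u) ∉ twistedSum A (g + e) f (2 * K) - twistedSum A (g + e) f (2 * K) := by
  rintro ⟨_, ⟨x, hx, y, a, hy, rfl⟩, _, ⟨x', hx', y', a', hy', rfl⟩, heq⟩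
  have ht : g + e ∈ H := H.add_mem hg he
  obtain ⟨h_eq, rfl⟩ := eq_and_eq_of_add_map_eq_add_map hf hH
    (H.add_mem (hA hx) (H.smul_mem a ht))
    (H.add_mem hg (H.add_mem (hA hx') (H.smul_mem a' ht))) (y := y) (y' := 1 + u + y')
    (by rw [map_add f (1 + u)]; grind)
  have dist_le : hammingDist (1 + u + y') (fun i => 1 + y' i) ≤ K := by
    simpa [hammingDist, hammingNorm] using hu
  obtain rfl : a = 1 + a' :=
    (hy.of_hammingDist_le dist_le).unique ((hy'.mono (Nat.zero_le _)).const_add 1)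
  exact heA ⟨x', hx', x, hx, by simp only [add_smul, one_smul] at h_eq; grind⟩

end TwistedSum

section BohrNeighborhoods

theorem IsBohrNhd.exists_finset {G : Type*} [AddCommGroup G] {B : Set G} {g : G}
    (hB : IsBohrNhd B g) :
    ∃ I : Finset (G →+ UnitAddCircle), ∀ x, (∀ ρ ∈ I, ρ x = ρ g) → x ∈ B := by
  rw [IsBohrNhd, nhds_iInf, Filter.mem_iInf] at hB
  obtain ⟨I, hI, V, hV, rfl⟩ := hB
  refine ⟨hI.toFinset, fun x hx => Set.mem_iInter.2 fun ρ => ?_⟩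
  obtain ⟨U, hU, hUV⟩ := nhds_induced ρ.1 g ▸ hV ρ
  refine hUV (Set.mem_preimage.2 ?_)
  rw [hx ρ (hI.mem_toFinset.2 ρ.2)]
  exact mem_of_mem_nhds hU

variable {ι : Type*} [Fintype ι]

/-- `F 1` is the sum of the values `F (Pi.single i 1)`. Replacing each index by a fixed
representative of those with the same value moves this sum to few coordinates. -/
theorem exists_hammingNorm_le_map_one_add_eq_zero {R M : Type*} [DecidableEq ι] [Ring R]
    [DecidableEq R] [AddCommGroup M] (F : (ι → R) →+ M) :
    ∃ u : ι → R, hammingNorm u ≤ (Set.range fun i => F (Pi.single i 1)).ncard ∧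
      F (1 + u) = 0 := by
  set v : ι → M := fun i => F (Pi.single i 1)
  set s : ι → ι := fun i => Set.rangeSplitting v (Set.rangeFactorization v i)
  have apply_s (i : ι) : v (s i) = v i := Set.apply_rangeSplitting v _
  have ncard_range_s : (Set.range s).ncard ≤ (Set.range v).ncard := by
    rw [← Nat.card_coe_set_eq (Set.range v), ← Set.ncard_univ]
    refine (Set.ncard_le_ncard ?_ (Set.toFinite _)).trans
      (Set.ncard_image_le (f := Set.rangeSplitting v))
    rintro _ ⟨i, rfl⟩
    exact ⟨_, trivial, rfl⟩
  refine ⟨-∑ i, Pi.single (s i) 1, le_trans ?_ ncard_range_s, ?_⟩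
  · rw [hammingNorm, ← Set.ncard_coe_finset]
    refine Set.ncard_le_ncard fun i hi => ?_
    contrapose! hi
    have sum_eq_zero : ∑ j, (Pi.single (s j) 1 : ι → R) i = 0 :=
      Finset.sum_eq_zero fun j _ => Pi.single_eq_of_ne (fun hij => hi ⟨j, hij.symm⟩) 1
    simp [Finset.sum_apply, sum_eq_zero]
  · rw [← Finset.univ_sum_single (1 : ι → R), map_add, map_neg, map_sum, map_sum, add_neg_eq_zero]
    exact Finset.sum_congr rfl fun i _ => (apply_s i).symm

theorem exists_hammingNorm_le_forall_map_eq_zero {p : ℕ} [NeZero p] {G : Type*} [AddCommGroup G]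
    (f : (ι → ZMod p) →+ G) (I : Finset (G →+ UnitAddCircle)) :
    ∃ u : ι → ZMod p, hammingNorm u ≤ p ^ #I ∧ ∀ ρ ∈ I, ρ (f (1 + u)) = 0 := by
  classical
  set F : (ι → ZMod p) →+ I → UnitAddCircle :=
    (AddMonoidHom.pi fun ρ : I => (ρ : G →+ UnitAddCircle)).comp f
  obtain ⟨u, hu, hFu⟩ := exists_hammingNorm_le_map_one_add_eq_zero F
  refine ⟨u, hu.trans ?_, fun ρ hρ => congrFun hFu ⟨ρ, hρ⟩⟩
  have range_subset : (Set.range fun i => F (Pi.single i 1)) ⊆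
      Set.univ.pi fun _ => {x : UnitAddCircle | p • x = 0} := by
    rintro _ ⟨i, rfl⟩ ρ -
    have : p • F (Pi.single i 1) = 0 := by simp [← map_nsmul, ← Pi.single_smul]
    exact congrFun this ρ
  have encard_torsion_le : {x : UnitAddCircle | p • x = 0}.encard ≤ p :=
    AddCircle.card_torsion_le_of_isSMulRegular 1 p (NeZero.ne p) <|
      .of_right_eq_zero_of_smul fun _ => by simp [NeZero.ne p]
  rw [← ENat.natCast_le_natCast, (Set.finite_range _).cast_ncard_eq]
  calc _ ≤ _ := Set.encard_le_encard range_subset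
    _ = {x : UnitAddCircle | p • x = 0}.encard ^ #I := by simp
    _ ≤ (p ^ #I : ℕ) := by push_cast; gcongr

end BohrNeighborhoods

section Coordinates

variable {p m n : ℕ}

/-- The vectors of `Gp p` supported on the first `m` coordinates. -/
def initialSubmodule (p m : ℕ) : Submodule (ZMod p) (Gp p) :=
  Finsupp.supported (ZMod p) (ZMod p) (Set.Iio m)

theorem initialSubmodule_mono (h : m ≤ n) : initialSubmodule p m ≤ initialSubmodule p n :=
  Finsupp.supported_mono (Set.Iio_subset_Iio h)

theorem exists_mem_initialSubmodule (x : Gp p) : ∃ m, x ∈ initialSubmodule p m :=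
  ⟨x.support.sup id + 1, fun _ hi => Nat.lt_succ_of_le (Finset.le_sup (f := id) hi)⟩

theorem single_zero_mem_initialSubmodule (hm : 0 < m) (a : ZMod p) :
    Finsupp.single 0 a ∈ initialSubmodule p m :=
  Finsupp.single_mem_supported _ a hm

theorem ncard_initialSubmodule (p m : ℕ) [NeZero p] :
    (initialSubmodule p m : Set (Gp p)).ncard = p ^ m := by
  rw [← Nat.card_coe_set_eq]
  refine (Nat.card_congr ((Finsupp.supportedEquivFinsupp (R := ZMod p) (Set.Iio m)).toEquiv.trans
    Finsupp.equivFunOnFinite)).trans ?_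
  simp

theorem finite_initialSubmodule (p m : ℕ) [NeZero p] :
    (initialSubmodule p m : Set (Gp p)).Finite :=
  Set.finite_of_ncard_ne_zero (by rw [ncard_initialSubmodule]; exact (NeZero.ne _))

/-- The embedding of `(ZMod p) ^ n` as the coordinates `m, …, m + n - 1` of `Gp p`. -/
noncomputable def blockEmbedding (p m n : ℕ) : (Fin n → ZMod p) →ₗ[ZMod p] Gp p :=
  Finsupp.lmapDomain (ZMod p) (ZMod p) (fun i : Fin n => m + i) ∘ₗ
    (Finsupp.linearEquivFunOnFinite (ZMod p) (ZMod p) (Fin n)).symm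

theorem blockEmbedding_injective (p m n : ℕ) : Function.Injective (blockEmbedding p m n) :=
  (Finsupp.mapDomain_injective fun _ _ h => Fin.ext (Nat.add_left_cancel h)).comp
    (LinearEquiv.injective _)

theorem range_blockEmbedding (p m n : ℕ) : LinearMap.range (blockEmbedding p m n) =
    Finsupp.supported (ZMod p) (ZMod p) (Set.range fun i : Fin n => m + i) := by
  rw [blockEmbedding, LinearEquiv.range_comp, ← Submodule.map_top, ← Finsupp.supported_univ,
    Finsupp.lmapDomain_supported, Set.image_univ]

theorem disjoint_initialSubmodule_range_blockEmbedding (p m n : ℕ) :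
    Disjoint (initialSubmodule p m) (LinearMap.range (blockEmbedding p m n)) := by
  rw [range_blockEmbedding, initialSubmodule]
  refine Finsupp.disjoint_supported_supported (Set.disjoint_left.2 ?_)
  rintro _ hi ⟨j, rfl⟩
  exact (Nat.le_add_right m j).not_gt hi

theorem initialSubmodule_sup_range_blockEmbedding_le (p m n : ℕ) :
    initialSubmodule p m ⊔ LinearMap.range (blockEmbedding p m n) ≤
      initialSubmodule p (m + n) := by
  refine sup_le (initialSubmodule_mono (Nat.le_add_right m n)) ?_
  rw [range_blockEmbedding]
  refine Finsupp.supported_mono ?_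
  rintro _ ⟨i, rfl⟩
  exact Nat.add_lt_add_left i.2 m

end Coordinates

section Stages

variable {p : ℕ} {c : ℝ}

/-- A finite approximation of the set in the first part of the theorem: a subset of
`initialSubmodule p level` of relative density greater than `c` whose differences avoid the first
basis vector. -/
structure Stage (p : ℕ) (c : ℝ) where
  level : ℕ
  level_pos : 0 < level
  carrier : Set (Gp p)
  carrier_subset : carrier ⊆ initialSubmodule p level
  single_notMem_sub : Finsupp.single 0 1 ∉ carrier - carrier
  lt_density : c < carrier.ncard / (p : ℝ) ^ level

/-- A larger stage creates no new differences in the subgroup of a smaller one. -/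
instance : Preorder (Stage p c) where
  le S T := S.level ≤ T.level ∧ S.carrier ⊆ T.carrier ∧
    (T.carrier - T.carrier) ∩ initialSubmodule p S.level ⊆ S.carrier - S.carrier
  le_refl S := ⟨le_rfl, subset_rfl, Set.inter_subset_left⟩
  le_trans _ _ _ := fun ⟨hl, hc, hd⟩ ⟨hl', hc', hd'⟩ => ⟨hl.trans hl', hc.trans hc',
    fun _ ⟨hx, hxS⟩ => hd ⟨hd' ⟨hx, initialSubmodule_mono hl hxS⟩, hxS⟩⟩

theorem nonempty_stage (hc : c < ((p / 2 : ℕ) : ℝ) / p) : Nonempty (Stage p c) := by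
  set f : ℕ → Gp p := fun j => Finsupp.single 0 ((2 * j : ℕ) : ZMod p) with hf
  have cast_injOn : Set.InjOn ((↑) : ℕ → ZMod p) (Set.Iio p) := CharP.natCast_injOn_Iio _ p
  have f_injOn : Set.InjOn f (Set.Iio (p / 2)) := by
    intro i hi j hj h
    rw [Set.mem_Iio] at hi hj
    have := cast_injOn (by grind) (by grind) (Finsupp.single_injective 0 h)
    omega
  refine ⟨{
    level := 1
    level_pos := one_pos
    carrier := f '' Set.Iio (p / 2)
    carrier_subset := by
      rintro _ ⟨j, -, rfl⟩
      exact single_zero_mem_initialSubmodule one_pos _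
    single_notMem_sub := ?_
    lt_density := by rwa [f_injOn.ncard_image, Set.ncard_Iio_nat, pow_one] }⟩
  rintro ⟨_, ⟨i, hi, rfl⟩, _, ⟨j, hj, rfl⟩, hij⟩
  rw [Set.mem_Iio] at hi hj
  have cast_eq : ((2 * i : ℕ) : ZMod p) = (1 + 2 * j : ℕ) := by
    simp only [hf, ← Finsupp.single_sub] at hij
    rw [sub_eq_iff_eq_add.1 (Finsupp.single_injective 0 hij)]
    push_cast
    rfl
  have := cast_injOn (by grind) (by grind) cast_eq
  omega

theorem iUnion_carrier_sub_inter_subset {S : ℕ → Stage p c} (hS : Monotone S) (i : ℕ) :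
    ((⋃ j, (S j).carrier) - ⋃ j, (S j).carrier) ∩ initialSubmodule p (S i).level ⊆
      (S i).carrier - (S i).carrier := by
  rintro _ ⟨⟨x, hx, y, hy, rfl⟩, hxy⟩
  obtain ⟨j, hj⟩ := Set.mem_iUnion.1 hx
  obtain ⟨k, hk⟩ := Set.mem_iUnion.1 hy
  set m := max i (max j k)
  have hx' : x ∈ (S m).carrier := (hS (by omega : j ≤ m)).2.1 hj
  have hy' : y ∈ (S m).carrier := (hS (by omega : k ≤ m)).2.1 hk
  exact (hS (le_max_left i _)).2.2 ⟨Set.sub_mem_sub hx' hy', hxy⟩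

variable [NeZero p]

namespace Stage

theorem exists_extension (S : Stage p c) {g : Gp p} (hg : g ∈ initialSubmodule p S.level)
    (K N : ℕ) : ∃ n ≥ N, ∃ T ≥ S, T.level = S.level + n ∧ ∀ u : Fin n → ZMod p,
      hammingNorm u ≤ K →
        g + blockEmbedding p S.level n (1 + u) ∉ T.carrier - T.carrier := by
  have he : Finsupp.single 0 1 ∈ initialSubmodule p S.level :=
    single_zero_mem_initialSubmodule S.level_pos 1
  have ht := add_mem hg he
  have tendsto_density := (tendsto_ncard_exists_isPlurality (α := ZMod p) (2 * K)).const_mul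
    (S.carrier.ncard / (p : ℝ) ^ S.level)
  rw [mul_one, ZMod.card] at tendsto_density
  obtain ⟨n, hn, hN, hK⟩ := ((tendsto_density.eventually_const_lt S.lt_density).and
    ((eventually_ge_atTop N).and (eventually_gt_atTop (2 * K)))).exists
  have hf := blockEmbedding_injective p S.level n
  have hH := disjoint_initialSubmodule_range_blockEmbedding p S.level n
  have diff_subset := twistedSum_sub_twistedSum_inter_subset (L := 2 * K) hf hH S.carrier_subset ht
  refine ⟨n, hN, {
    level := S.level + n
    level_pos := Nat.add_pos_left S.level_pos n
    carrier := twistedSum S.carrier (g + Finsupp.single 0 1) (blockEmbedding p S.level n) (2 * K)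
    carrier_subset := (twistedSum_subset S.carrier_subset ht).trans
      (initialSubmodule_sup_range_blockEmbedding_le p S.level n)
    single_notMem_sub := fun h => S.single_notMem_sub (diff_subset ⟨h, he⟩)
    lt_density := ?_ }, ⟨Nat.le_add_right _ _, subset_twistedSum (by simpa using hK), diff_subset⟩,
    rfl, fun u hu => add_map_one_add_notMem_twistedSum_sub hf hH S.carrier_subset hg he
      S.single_notMem_sub hu⟩
  rw [ncard_twistedSum hf hH S.carrier_subset ht, pow_add]
  push_cast
  rwa [mul_div_mul_comm]

/-- The differences of `S` avoid a point of every Bohr neighborhood of `g` given by at most `k`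
characters. -/
def Avoids (S : Stage p c) (g : Gp p) (k : ℕ) : Prop :=
  ∀ I : Finset (Gp p →+ UnitAddCircle), #I ≤ k → ∃ x ∈ initialSubmodule p S.level,
    x ∉ S.carrier - S.carrier ∧ ∀ ρ ∈ I, ρ x = ρ g

theorem isCofinal_avoids (g : Gp p) (k : ℕ) :
    IsCofinal {S : Stage p c | g ∈ initialSubmodule p S.level ∧ S.Avoids g k} := by
  intro S
  obtain ⟨m, hm⟩ := exists_mem_initialSubmodule g
  obtain ⟨n, hn, T, hST, hT, -⟩ := S.exists_extension (zero_mem _) 0 m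
  have hgT : g ∈ initialSubmodule p T.level := initialSubmodule_mono (by omega) hm
  obtain ⟨n', -, U, hTU, hU, hUg⟩ := T.exists_extension hgT (p ^ k) 0
  have hgU := initialSubmodule_mono hTU.1 hgT
  refine ⟨U, ⟨hgU, fun I hI => ?_⟩, hST.trans hTU⟩
  obtain ⟨u, hu, hIu⟩ := exists_hammingNorm_le_forall_map_eq_zero
    (blockEmbedding p T.level n' : (Fin n' → ZMod p) →+ Gp p) I
  refine ⟨g + blockEmbedding p T.level n' (1 + u), add_mem hgU ?_,
    hUg u (hu.trans (Nat.pow_le_pow_right (NeZero.pos p) hI)), fun ρ hρ => ?_⟩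
  · rw [hU]
    exact initialSubmodule_sup_range_blockEmbedding_le p T.level n'
      (Submodule.mem_sup_right ⟨_, rfl⟩)
  · rw [map_add, add_eq_left]
    exact hIu ρ hρ

theorem exists_monotone_seq (S₀ : Stage p c) : ∃ S : ℕ → Stage p c, Monotone S ∧
    ∀ g k, ∃ i, g ∈ initialSubmodule p (S i).level ∧ (S i).Avoids g k := by
  let _ := Encodable.ofCountable (Gp p × ℕ)
  set 𝒟 : Gp p × ℕ → Order.Cofinal (Stage p c) := fun q => ⟨_, isCofinal_avoids q.1 q.2⟩
  exact ⟨_, Order.sequenceOfCofinals.monotone S₀ 𝒟,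
    fun g k => ⟨_, Order.sequenceOfCofinals.encode_mem S₀ 𝒟 (g, k)⟩⟩

end Stage

theorem le_upperBanachDensity_iUnion_carrier {S : ℕ → Stage p c} (hS : Monotone S)
    (hcover : ∀ g, ∃ i, g ∈ initialSubmodule p (S i).level) :
    c ≤ upperBanachDensity (⋃ i, (S i).carrier) := by
  set Φ : ℕ → Finset (Gp p) := fun i => (finite_initialSubmodule p (S i).level).toFinset
  have coe_Φ (i : ℕ) : (Φ i : Set (Gp p)) = initialSubmodule p (S i).level :=
    Set.Finite.coe_toFinset _
  have card_Φ (i : ℕ) : #(Φ i) = p ^ (S i).level := by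
    rw [← Set.ncard_coe_finset, coe_Φ, ncard_initialSubmodule]
  have isFolnerSeq : IsFolnerSeq Φ := by
    refine isFolnerSeq_of_eventually_vadd_eq
      (fun i => ⟨0, by rw [← Finset.mem_coe, coe_Φ]; exact zero_mem _⟩) fun g => ?_
    obtain ⟨i, hi⟩ := hcover g
    filter_upwards [eventually_ge_atTop i] with j hij
    rw [coe_Φ]
    exact vadd_coe_set (initialSubmodule_mono (hS hij).1 hi)
  refine le_trans (le_upperDensity (.of_forall fun i => ?_))
    (upperDensity_le_upperBanachDensity isFolnerSeq _)
  rw [card_Φ, coe_Φ]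
  refine (S i).lt_density.le.trans ?_
  push_cast
  gcongr
  · exact (finite_initialSubmodule p _).inter_of_right _
  · exact Set.subset_inter (Set.subset_iUnion (fun j => (S j).carrier) i) (S i).carrier_subset

theorem exists_le_upperBanachDensity_forall_isBohrNhd_not_subset
    (hc : c < ((p / 2 : ℕ) : ℝ) / p) : ∃ A : Set (Gp p), c ≤ upperBanachDensity A ∧
      ∀ (g : Gp p) (B : Set (Gp p)), IsBohrNhd B g → ¬ B ⊆ A - A := by
  obtain ⟨S₀⟩ := nonempty_stage hc
  obtain ⟨S, hS, havoids⟩ := S₀.exists_monotone_seq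
  refine ⟨⋃ i, (S i).carrier, le_upperBanachDensity_iUnion_carrier hS
    fun g => (havoids g 0).imp fun _ => And.left, fun g B hB hBA => ?_⟩
  obtain ⟨I, hI⟩ := hB.exists_finset
  obtain ⟨i, -, hi⟩ := havoids g #I
  obtain ⟨x, hx, hxS, hIx⟩ := hi I le_rfl
  exact hxS (iUnion_carrier_sub_inter_subset hS i ⟨hBA (hI x hIx), hx⟩)

end Stages

theorem criticalDensity_eq {p : ℕ} (hp : p.Prime) :
    criticalDensity p = ((p / 2 : ℕ) : ℝ) / p := by
  rw [criticalDensity]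
  split_ifs with h
  · simp [h]
  · have hp0 : (p : ℝ) ≠ 0 := Nat.cast_ne_zero.2 hp.ne_zero
    obtain ⟨k, rfl⟩ := hp.odd_of_ne_two h
    rw [show (2 * k + 1) / 2 = k by omega]
    field_simp
    push_cast
    ring

theorem theorem1p2_general (p : ℕ) [NeZero p] :
    (∀ ε : ℝ, 0 < ε → ∃ A : Set (Gp p),
      ((p / 2 : ℕ) : ℝ) / p - ε < upperBanachDensity A ∧
        ∀ (g : Gp p) (B : Set (Gp p)), IsBohrNhd B g → ¬ B ⊆ A - A) ∧
    (∀ A : Set (Gp p), ((p / 2 : ℕ) : ℝ) / p < upperBanachDensity A → A - A = Set.univ) := by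
  refine ⟨fun ε hε => ?_, fun A hA => Set.eq_univ_of_forall fun g => ?_⟩
  · obtain ⟨A, hA, hAB⟩ := exists_le_upperBanachDensity_forall_isBohrNhd_not_subset
      (sub_lt_self (((p / 2 : ℕ) : ℝ) / p) (half_pos hε))
    exact ⟨A, by linarith, hAB⟩
  · by_contra hg
    exact hA.not_ge (upperBanachDensity_le_of_notMem_sub hg)

theorem theorem1p2 (p : ℕ) (hp : p.Prime) :
    (∀ ε : ℝ, 0 < ε → ∃ A : Set (Gp p),
      criticalDensity p - ε < upperBanachDensity A ∧
        ∀ (g : Gp p) (B : Set (Gp p)), IsBohrNhd B g → ¬ B ⊆ A - A) ∧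
    (∀ A : Set (Gp p), criticalDensity p < upperBanachDensity A → A - A = Set.univ) := by
  have : NeZero p := ⟨hp.ne_zero⟩
  exact criticalDensity_eq hp ▸ theorem1p2_general p
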